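/- Let $N$ be a finitely generated free abelian group, $N_{\mathbb R}=\mathbb R\otimes_{\mathbb Z}N$ and $M=\operatorname{Hom}(N,\mathbb Z)$, with pairing $\langle m,v\rangle$ extended $\mathbb R$-linearly to $v\in N_{\mathbb R}$. Let $\Sigma$ be a unimodular fan in $N_{\mathbb R}$, i.e. a finite collection of strongly convex rational polyhedral cones, closed under taking faces, any two of which intersect in a common face, such that each cone is generated by part of a $\mathbb Z$-basis of $N$. Let $|\Sigma|$ be the union of the cones, $\Sigma(1)$ the set of rays (one-dimensional cones), and $u_\rho\in N$ the primitive generator of $\rho\in\Sigma(1)$. Let $\mathrm L(\Sigma)$ be the group of functions $|\Sigma|\to\mathbb R$ that are restrictions of elements of $M$, and $\mathrm{PL}(\Sigma)$ the group of functions $f:|\Sigma|\to\mathbb R$ such that for every $\sigma\in\Sigma$ there is $m_\sigma\in M$ with $f|_\sigma=m_\sigma|_\sigma$. Let $\mathrm{PE}(\Sigma)$ be the ring of functions $|\Sigma|\to\mathbb R$ of the form $\sum_{i=1}^n a_ie^{f_i}$ with $n\in\mathbb N$, $a_i\in\mathbb Z$, $f_i\in\mathrm{PL}(\Sigma)$,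 and set \[\underline{\mathrm{PE}}(\Sigma)=\mathrm{PE}(\Sigma)\big/\langle e^\ell-1\mid \ell\in\mathrm L(\Sigma)\rangle .\] For $\rho\in\Sigma(1)$ let $\delta_\rho\in\mathrm{PL}(\Sigma)$ be the unique element taking the value $1$ at $u_\rho$ and vanishing on all other rays of $\Sigma$. Then the $\mathbb Z$-algebra homomorphism \[\phi:\mathbb Z[x_\rho\mid\rho\in\Sigma(1)]\to\underline{\mathrm{PE}}(\Sigma),\qquad \phi(x_\rho)=1-[e^{\delta_\rho}],\] is surjective with kernel $\mathcal I+\mathcal J$, where \[\mathcal I=\langle x_{\rho_1}\cdots x_{\rho_k}\mid \rho_1,\dots,\rho_k\text{ do not lie on a common cone of }\Sigma\rangle,\] \[\mathcal J=\Big\langle\prod_{\rho:\,\langle m,u_\rho\rangle>0}(1-x_\rho)^{\langle m,u_\rho\rangle}-\prod_{\rho:\,\langle m,u_\rho\rangle<0}(1-x_\rho)^{-\langle m,u_\rho\rangle}\;\Big|\;m\in M\Big\rangle .\] Consequently $\phi$ induces an isomorphism of $\mathbb Z$-algebras \[\mathbb Z[x_\rho\mid\rho\in\Sigma(1)]/(\mathcal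 I+\mathcal J)\;\cong\;\underline{\mathrm{PE}}(\Sigma).\] -/

import Mathlib

open scoped TensorProduct

noncomputable section

namespace ToricFan

/-! ### The lattice, its real vector space and its dual -/

/-- The real vector space `N_ℝ = ℝ ⊗_ℤ N`. -/
abbrev RealSpace (N : Type*) [AddCommGroup N] : Type _ := ℝ ⊗[ℤ] N

/-- The canonical map `N → N_ℝ`. -/
def latticePt {N : Type*} [AddCommGroup N] (v : N) : RealSpace N := (1 : ℝ) ⊗ₜ[ℤ] v

/-- The pairing `⟨m, -⟩ : N_ℝ → ℝ` with `m ∈ M = Hom(N, ℤ)`, the `ℝ`-linear extension of `m`. -/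
def pairing {N : Type*} [AddCommGroup N] (m : Module.Dual ℤ N) : RealSpace N →ₗ[ℝ] ℝ :=
  (TensorProduct.AlgebraTensorModule.rid ℤ ℝ ℝ).toLinearMap ∘ₗ LinearMap.baseChange ℝ m

/-! ### Fans -/

/-- A (rational, polyhedral) fan in `N_ℝ`: a finite collection of strongly convex rational
polyhedral cones, closed under taking faces, in which any two cones meet along a common face. -/
structure Fan (N : Type*) [AddCommGroup N] where
  /-- the cones of the fan -/
  cones : Set (PointedCone ℝ (RealSpace N))
  finite_cones : cones.Finite
  rational : ∀ σ ∈ cones, ∃ G : Set N, G.Finite ∧ σ = PointedCone.hull ℝ (latticePt '' G)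
  salient : ∀ σ ∈ cones, (PointedCone.toConvexCone σ).Salient
  face_mem : ∀ σ ∈ cones, ∀ τ : PointedCone ℝ (RealSpace N), τ.IsFaceOf σ → τ ∈ cones
  inter_face : ∀ σ ∈ cones, ∀ τ ∈ cones, (σ ⊓ τ).IsFaceOf σ ∧ (σ ⊓ τ).IsFaceOf τ

/-- A unimodular fan: every cone is generated by part of a `ℤ`-basis of `N`. -/
structure UnimodularFan (N : Type*) [AddCommGroup N] extends Fan N where
  unimodular : ∀ σ ∈ cones, ∃ (b : Module.Basis (Fin (Module.finrank ℤ N)) ℤ N)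
    (s : Set (Fin (Module.finrank ℤ N))), σ = PointedCone.hull ℝ (latticePt '' (b '' s))

/-- The dimension of a cone. -/
def coneDim {N : Type*} [AddCommGroup N] (σ : PointedCone ℝ (RealSpace N)) : ℕ :=
  Module.finrank ℝ (Submodule.span ℝ (σ : Set (RealSpace N)))

/-- `u` is the primitive generator of `ρ`: the lattice points of `ρ` are exactly the
nonnegative integer multiples of `u`. -/
def IsPrimitiveGenerator {N : Type*} [AddCommGroup N] (ρ : PointedCone ℝ (RealSpace N))
    (u : N) : Prop :=
  ∀ v : N, latticePt v ∈ ρ ↔ ∃ k : ℕ, v = k • u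

/-! ### Auxiliary facts on the pairing and on unimodular cones -/

section Aux

variable {N : Type*} [AddCommGroup N]

lemma pairing_latticePt (m : Module.Dual ℤ N) (v : N) : pairing m (latticePt v) = m v := by
  simp [pairing, latticePt]

lemma pairing_zero : pairing (0 : Module.Dual ℤ N) = 0 := by
  simp [pairing]

lemma pairing_add (m m' : Module.Dual ℤ N) : pairing (m + m') = pairing m + pairing m' := by
  simp [pairing, LinearMap.baseChange_add, LinearMap.comp_add]

lemma pairing_neg (m : Module.Dual ℤ N) : pairing (-m) = -pairing m := by
  simp [pairing, LinearMap.baseChange_neg, LinearMap.comp_neg]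

lemma latticePt_mem_hull {ι : Type*} (b : Module.Basis ι ℤ N) {s : Set ι} {i : ι} (hi : i ∈ s) :
    latticePt (b i) ∈ PointedCone.hull ℝ (latticePt '' (b '' s)) :=
  Submodule.subset_span ⟨_, ⟨i, hi, rfl⟩, rfl⟩

variable {ι : Type*} [Fintype ι] (b : Module.Basis ι ℤ N)

lemma sum_pairing_coord (x : RealSpace N) :
    ∑ i, pairing (b.coord i) x • latticePt (b i) = x := by
  classical
  induction x using TensorProduct.induction_on with
  | zero => simp
  | add x y hx hy => simp only [map_add, add_smul, Finset.sum_add_distrib, hx, hy]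
  | tmul r v =>
    have h : ∀ i, pairing (b.coord i) (r ⊗ₜ[ℤ] v) • latticePt (b i) =
        r ⊗ₜ[ℤ] (b.repr v i • b i) := by
      intro i
      simp only [pairing, latticePt, LinearMap.comp_apply, LinearMap.baseChange_tmul,
        LinearEquiv.coe_coe, TensorProduct.AlgebraTensorModule.rid_tmul, Module.Basis.coord_apply,
        TensorProduct.smul_tmul', TensorProduct.tmul_smul]
      simp
    simp only [h, ← TensorProduct.tmul_sum, b.sum_repr]

lemma mem_hull_iff (s : Set ι) (x : RealSpace N) :
    x ∈ PointedCone.hull ℝ (latticePt '' (b '' s)) ↔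
      (∀ i, 0 ≤ pairing (b.coord i) x) ∧ ∀ i, i ∉ s → pairing (b.coord i) x = 0 := by
  classical
  constructor
  · intro hx
    induction hx using Submodule.span_induction with
    | mem x h =>
      obtain ⟨_, ⟨j, hj, rfl⟩, rfl⟩ := h
      simp only [pairing_latticePt, Module.Basis.coord_apply, Module.Basis.repr_self,
        Finsupp.single_apply]
      refine ⟨fun i => by split_ifs <;> simp, fun i hi => ?_⟩
      rw [if_neg (by rintro rfl; exact hi hj)]; simp
    | zero => simp
    | add x y _ _ hx hy =>
      simp only [map_add]
      exact ⟨fun i => add_nonneg (hx.1 i) (hy.1 i), fun i hi => by rw [hx.2 i hi, hy.2 i hi, add_zero]⟩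
    | smul a x _ hx =>
      have h : ∀ i, pairing (b.coord i) (a • x) = (a : ℝ) * pairing (b.coord i) x := by
        intro i
        exact (pairing (b.coord i)).map_smul (a : ℝ) x
      simp only [h]
      exact ⟨fun i => mul_nonneg a.2 (hx.1 i), fun i hi => by rw [hx.2 i hi, mul_zero]⟩
  · rintro ⟨h0, hs⟩
    rw [← sum_pairing_coord b x]
    refine Submodule.sum_mem _ fun i _ => ?_
    by_cases hi : i ∈ s
    · exact Submodule.smul_mem _ (⟨_, h0 i⟩ : {c : ℝ // 0 ≤ c})
        (Submodule.subset_span ⟨_, ⟨i, hi, rfl⟩, rfl⟩)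
    · rw [hs i hi, zero_smul]; exact Submodule.zero_mem _

lemma hull_isFaceOf {s t : Set ι} (hts : t ⊆ s) :
    (PointedCone.hull ℝ (latticePt '' (b '' t))).IsFaceOf
      (PointedCone.hull ℝ (latticePt '' (b '' s))) := by
  refine ⟨Submodule.span_mono (Set.image_mono (Set.image_mono hts)), ?_⟩
  intro x y a hx hy ha hxy
  rw [mem_hull_iff] at hx hy hxy ⊢
  refine ⟨hx.1, fun i hi => ?_⟩
  have h1 := hxy.2 i hi
  rw [map_add, map_smul, smul_eq_mul] at h1
  have h2 := hx.1 i
  have h3 := hy.1 i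
  nlinarith [mul_nonneg ha.le h2, mul_pos_iff_of_pos_left (b := pairing (b.coord i) x) ha]

lemma coneDim_hull (s : Set ι) :
    coneDim (PointedCone.hull ℝ (latticePt '' (b '' s))) = s.ncard := by
  classical
  have hspan : Submodule.span ℝ
      ((PointedCone.hull ℝ (latticePt '' (b '' s)) : PointedCone ℝ (RealSpace N)) :
        Set (RealSpace N)) = Submodule.span ℝ (latticePt '' (b '' s)) :=
    le_antisymm (Submodule.span_le.2 (PointedCone.hull_le_span ℝ _))
      (Submodule.span_mono Submodule.subset_span)
  have hli : LinearIndependent ℝ (fun i : ι => latticePt (b i)) := by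
    have h := (b.baseChange ℝ).linearIndependent
    have h2 : (⇑(b.baseChange ℝ) : ι → RealSpace N) = fun i => latticePt (b i) := by
      ext i; simp [latticePt]
    rwa [h2] at h
  have himg : latticePt '' (b '' s) = Set.range (fun i : s => latticePt (b i)) := by
    rw [Set.image_image, Set.image_eq_range]
  rw [coneDim, hspan, himg]
  have := finrank_span_eq_card (hli.comp ((↑) : s → ι) Subtype.val_injective)
  rw [← Nat.card_coe_set_eq, Nat.card_eq_fintype_card]
  exact this

lemma isPrimitiveGenerator_hull (i : ι) :
    IsPrimitiveGenerator (PointedCone.hull ℝ (latticePt '' (b '' {i}))) (b i) := by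
  classical
  intro v
  rw [mem_hull_iff]
  simp only [pairing_latticePt, Int.cast_nonneg_iff, Int.cast_eq_zero, Set.mem_singleton_iff]
  constructor
  · rintro ⟨h0, h1⟩
    refine ⟨(b.coord i v).toNat, ?_⟩
    rw [← natCast_zsmul, Int.toNat_of_nonneg (h0 i)]
    conv_lhs => rw [← b.sum_repr v]
    refine Finset.sum_eq_single i (fun j _ hj => ?_) (by simp)
    have := h1 j hj
    rw [Module.Basis.coord_apply] at this
    rw [this, zero_smul]
  · rintro ⟨k, rfl⟩
    simp only [map_nsmul, Module.Basis.coord_apply, Module.Basis.repr_self, Finsupp.single_apply]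
    refine ⟨fun j => by split_ifs <;> simp, fun j hj => ?_⟩
    rw [if_neg (fun h => hj h.symm)]; simp

lemma IsPrimitiveGenerator.mem {ρ : PointedCone ℝ (RealSpace N)} {u : N}
    (h : IsPrimitiveGenerator ρ u) : latticePt u ∈ ρ :=
  (h u).2 ⟨1, (one_smul _ _).symm⟩

lemma IsPrimitiveGenerator.unique [Module.Free ℤ N] {ρ : PointedCone ℝ (RealSpace N)} {u u' : N}
    (h : IsPrimitiveGenerator ρ u) (h' : IsPrimitiveGenerator ρ u') : u = u' := by
  obtain ⟨k, hk⟩ := (h' u).1 h.mem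
  obtain ⟨l, hl⟩ := (h u').1 h'.mem
  by_cases hu : u = 0
  · rw [hl, hu, smul_zero]
  have h1 : ((k : ℤ) * l) • u = (1 : ℤ) • u := by
    rw [one_smul, mul_smul, natCast_zsmul, natCast_zsmul, ← hl, ← hk]
  have h2 : (k : ℤ) * l = 1 := smul_left_injective ℤ hu h1
  have h3 : k = 1 := Nat.eq_one_of_mul_eq_one_right (by exact_mod_cast h2)
  rw [hk, h3, one_smul]

end Aux

namespace Fan

variable {N : Type*} [AddCommGroup N] (F : Fan N)

/-- The set `Σ(1)` of rays (one-dimensional cones) of the fan, as a type. -/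
def Ray : Type _ := {ρ : PointedCone ℝ (RealSpace N) // ρ ∈ F.cones ∧ coneDim ρ = 1}

instance : Finite F.Ray := (F.finite_cones.subset (fun _ h => h.1) :
  {ρ | ρ ∈ F.cones ∧ coneDim ρ = 1}.Finite).to_subtype

instance : Fintype F.Ray := Fintype.ofFinite _

/-- The support `|Σ|`, the union of all cones. -/
def support : Set (RealSpace N) := {x | ∃ σ ∈ F.cones, x ∈ σ}

/-- The group `L(Σ)` of integral linear functions on `|Σ|`. -/
def L : AddSubgroup (F.support → ℝ) where
  carrier := {f | ∃ m : Module.Dual ℤ N, ∀ x : F.support, f x = pairing m x}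
  zero_mem' := ⟨0, fun x => by simp [pairing_zero]⟩
  add_mem' := by
    rintro f g ⟨m, hm⟩ ⟨m', hm'⟩
    exact ⟨m + m', fun x => by simp [pairing_add, hm, hm']⟩
  neg_mem' := by
    rintro f ⟨m, hm⟩
    exact ⟨-m, fun x => by simp [pairing_neg, hm]⟩

/-- The group `PL(Σ)` of integral piecewise-linear functions on `|Σ|`. -/
def PL : AddSubgroup (F.support → ℝ) where
  carrier := {f | ∀ σ ∈ F.cones, ∃ m : Module.Dual ℤ N,
    ∀ x : F.support, (x : RealSpace N) ∈ σ → f x = pairing m x}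
  zero_mem' := fun σ _ => ⟨0, fun x _ => by simp [pairing_zero]⟩
  add_mem' := by
    intro f g hf hg σ hσ
    obtain ⟨m, hm⟩ := hf σ hσ
    obtain ⟨m', hm'⟩ := hg σ hσ
    exact ⟨m + m', fun x hx => by simp [pairing_add, hm x hx, hm' x hx]⟩
  neg_mem' := by
    intro f hf σ hσ
    obtain ⟨m, hm⟩ := hf σ hσ
    exact ⟨-m, fun x hx => by simp [pairing_neg, hm x hx]⟩

/-- `G` is integral piecewise-exponential: `G = ∑ a_i e^{f_i}`, a finite sum with `a_i ∈ ℤ` and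
`f_i ∈ PL(Σ)`. -/
def IsPiecewiseExp (G : F.support → ℝ) : Prop :=
  ∃ (n : ℕ) (a : Fin n → ℤ) (f : Fin n → F.PL),
    ∀ x, G x = ∑ i, (a i : ℝ) * Real.exp ((f i : F.support → ℝ) x)

lemma isPiecewiseExp_of_fintype {ι : Type*} [Fintype ι] (a : ι → ℤ) (f : ι → F.PL)
    (G : F.support → ℝ) (h : ∀ x, G x = ∑ i, (a i : ℝ) * Real.exp ((f i : F.support → ℝ) x)) :
    F.IsPiecewiseExp G := by
  refine ⟨Fintype.card ι, a ∘ (Fintype.equivFin ι).symm, f ∘ (Fintype.equivFin ι).symm,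
    fun x => ?_⟩
  rw [h x]
  exact (Equiv.sum_comp (Fintype.equivFin ι).symm
    (fun i => (a i : ℝ) * Real.exp ((f i : F.support → ℝ) x))).symm

/-- The ring `PE(Σ)` of integral piecewise-exponential functions on `|Σ|`, with pointwise
operations. -/
def PE : Subring (F.support → ℝ) where
  carrier := {G | F.IsPiecewiseExp G}
  zero_mem' := F.isPiecewiseExp_of_fintype (ι := Fin 0) (fun _ => 0) (fun _ => 0) _ (by simp)
  one_mem' := F.isPiecewiseExp_of_fintype (ι := Unit) (fun _ => 1) (fun _ => 0) _ (by simp)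
  add_mem' := by
    rintro G H ⟨n, a, f, h⟩ ⟨n', a', f', h'⟩
    exact F.isPiecewiseExp_of_fintype (Sum.elim a a') (Sum.elim f f') _
      (fun x => by simp [h, h'])
  mul_mem' := by
    rintro G H ⟨n, a, f, h⟩ ⟨n', a', f', h'⟩
    refine F.isPiecewiseExp_of_fintype (fun p : Fin n × Fin n' => a p.1 * a' p.2)
      (fun p => f p.1 + f' p.2) _ (fun x => ?_)
    rw [Pi.mul_apply, h, h', Finset.sum_mul_sum, Fintype.sum_prod_type]
    refine Finset.sum_congr rfl fun i _ => Finset.sum_congr rfl fun j _ => ?_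
    simp only [AddSubgroup.coe_add, Pi.add_apply, Real.exp_add, Int.cast_mul]
    ring
  neg_mem' := by
    rintro G ⟨n, a, f, h⟩
    exact F.isPiecewiseExp_of_fintype (fun i => -a i) f _ (fun x => by simp [h])

/-- The exponential `e^f ∈ PE(Σ)` of `f ∈ PL(Σ)`. -/
def expPL (f : F.PL) : F.PE :=
  ⟨fun x => Real.exp ((f : F.support → ℝ) x),
    F.isPiecewiseExp_of_fintype (ι := Unit) (fun _ => 1) (fun _ => f) _ (by simp)⟩

lemma L_le_PL : F.L ≤ F.PL := by
  rintro f ⟨m, hm⟩ σ _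
  exact ⟨m, fun x _ => hm x⟩

/-- The ideal `⟨e^ℓ - 1 | ℓ ∈ L(Σ)⟩` of `PE(Σ)`. -/
def linearIdeal : Ideal F.PE :=
  Ideal.span (Set.range fun l : F.L => F.expPL ⟨l, F.L_le_PL l.2⟩ - 1)

/-- The quotient ring of `PE(Σ)` by `⟨e^ℓ - 1 | ℓ ∈ L(Σ)⟩`. -/
abbrev PEbar : Type _ := F.PE ⧸ F.linearIdeal

/-- The Stanley–Reisner ideal, generated by the products of rays that do not lie on a common
cone of the fan. -/
def idealI : Ideal (MvPolynomial F.Ray ℤ) :=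
  Ideal.span {p | ∃ T : Finset F.Ray, (¬ ∃ σ ∈ F.cones, ∀ ρ ∈ T, ρ.1 ≤ σ) ∧
    p = ∏ ρ ∈ T, MvPolynomial.X ρ}

end Fan

namespace UnimodularFan

variable {N : Type*} [AddCommGroup N] (F : UnimodularFan N)

lemma exists_isPrimitiveGenerator (ρ : F.Ray) : ∃ u : N, IsPrimitiveGenerator ρ.1 u := by
  obtain ⟨b, s, h⟩ := F.unimodular ρ.1 ρ.2.1
  have hd := ρ.2.2
  rw [h, coneDim_hull, Set.ncard_eq_one] at hd
  obtain ⟨i, rfl⟩ := hd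
  exact ⟨b i, h ▸ isPrimitiveGenerator_hull b i⟩

/-- The primitive generator `u_ρ ∈ N` of the ray `ρ`. -/
def gen (ρ : F.Ray) : N := (F.exists_isPrimitiveGenerator ρ).choose

lemma gen_spec (ρ : F.Ray) : IsPrimitiveGenerator ρ.1 (F.gen ρ) :=
  (F.exists_isPrimitiveGenerator ρ).choose_spec

/-- The primitive generator `u_ρ`, as a point of `|Σ|`. -/
def genPt (ρ : F.Ray) : F.support :=
  ⟨latticePt (F.gen ρ), ρ.1, ρ.2.1, (F.gen_spec ρ).mem⟩

/-- `f` is the Courant function of `ρ`: it takes the value `1` at `u_ρ` and vanishes along all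
other rays. -/
def IsCourant (ρ : F.Ray) (f : F.PL) : Prop :=
  (f : F.support → ℝ) (F.genPt ρ) = 1 ∧
    ∀ ρ' : F.Ray, ρ' ≠ ρ → ∀ x : F.support, (x : RealSpace N) ∈ ρ'.1 →
      (f : F.support → ℝ) x = 0

section Courant

variable [Module.Free ℤ N]

lemma ray_eq_hull (ρ : F.Ray) :
    ρ.1 = PointedCone.hull ℝ {latticePt (F.gen ρ)} := by
  obtain ⟨b, s, h⟩ := F.unimodular ρ.1 ρ.2.1
  have hd := ρ.2.2
  rw [h, coneDim_hull, Set.ncard_eq_one] at hd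
  obtain ⟨i, rfl⟩ := hd
  have := (F.gen_spec ρ).unique (h ▸ isPrimitiveGenerator_hull b i)
  rw [this, h, Set.image_singleton, Set.image_singleton]

lemma gen_injective : Function.Injective F.gen := by
  intro ρ ρ' h
  apply Subtype.ext
  rw [F.ray_eq_hull ρ, F.ray_eq_hull ρ', h]

variable {F} in
lemma exists_ray {σ : PointedCone ℝ (RealSpace N)} (hσ : σ ∈ F.cones)
    (b : Module.Basis (Fin (Module.finrank ℤ N)) ℤ N) (s : Set (Fin (Module.finrank ℤ N)))
    (h : σ = PointedCone.hull ℝ (latticePt '' (b '' s))) {i : Fin (Module.finrank ℤ N)}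
    (hi : i ∈ s) : ∃ ρ : F.Ray, F.gen ρ = b i := by
  have hmem := F.face_mem σ hσ _ (h ▸ hull_isFaceOf b (Set.singleton_subset_iff.2 hi))
  refine ⟨⟨_, hmem, by rw [coneDim_hull, Set.ncard_singleton]⟩, ?_⟩
  exact (F.gen_spec _).unique (isPrimitiveGenerator_hull b i)

lemma ray_le_of_mem (ρ : F.Ray) {τ : PointedCone ℝ (RealSpace N)}
    (h : latticePt (F.gen ρ) ∈ τ) : ρ.1 ≤ τ := by
  rw [F.ray_eq_hull ρ]
  exact Submodule.span_le.2 (Set.singleton_subset_iff.2 h)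

variable {F} in
lemma gen_mem_of_le {σ : PointedCone ℝ (RealSpace N)} (hσ : σ ∈ F.cones)
    (b : Module.Basis (Fin (Module.finrank ℤ N)) ℤ N) (s : Set (Fin (Module.finrank ℤ N)))
    (h : σ = PointedCone.hull ℝ (latticePt '' (b '' s))) (ρ : F.Ray) (hρ : ρ.1 ≤ σ) :
    ∃ i ∈ s, F.gen ρ = b i := by
  classical
  have hface : ρ.1.IsFaceOf σ := by
    have := (F.inter_face σ hσ ρ.1 ρ.2.1).1
    rwa [inf_eq_right.2 hρ] at this
  have hu : latticePt (F.gen ρ) ∈ ρ.1 := (F.gen_spec ρ).mem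
  have huσ := hρ hu
  rw [h, mem_hull_iff] at huσ
  have hne : ∃ i, pairing (b.coord i) (latticePt (F.gen ρ)) ≠ 0 := by
    by_contra! hall
    have h0 : latticePt (F.gen ρ) = 0 := by
      rw [← sum_pairing_coord b (latticePt (F.gen ρ))]
      simp [hall]
    have hd := ρ.2.2
    have hz : PointedCone.hull ℝ {(0 : RealSpace N)} = ⊥ := Submodule.span_zero_singleton _
    rw [F.ray_eq_hull ρ, h0, hz, coneDim] at hd
    have hs : Submodule.span ℝ
        (((⊥ : PointedCone ℝ (RealSpace N)) : Set (RealSpace N))) = ⊥ := by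
      rw [Submodule.span_eq_bot]
      intro x hx
      exact hx
    rw [hs, finrank_bot] at hd
    exact zero_ne_one hd
  obtain ⟨i, hi⟩ := hne
  have his : i ∈ s := by
    by_contra hn
    exact hi (huσ.2 i hn)
  have hpos : 0 < pairing (b.coord i) (latticePt (F.gen ρ)) := lt_of_le_of_ne (huσ.1 i) hi.symm
  refine ⟨i, his, ?_⟩
  have hbi : latticePt (b i) ∈ ρ.1 := by
    have hsum := sum_pairing_coord b (latticePt (F.gen ρ))
    rw [← Finset.add_sum_erase _ _ (Finset.mem_univ i)] at hsum
    refine hface.mem_of_smul_add_mem (a := pairing (b.coord i) (latticePt (F.gen ρ)))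
      (y := ∑ j ∈ Finset.univ.erase i,
        pairing (b.coord j) (latticePt (F.gen ρ)) • latticePt (b j)) ?_ ?_ hpos ?_
    · rw [h]; exact latticePt_mem_hull b his
    · rw [h]
      refine Submodule.sum_mem _ fun j _ => ?_
      by_cases hj : j ∈ s
      · exact Submodule.smul_mem _ (⟨_, huσ.1 j⟩ : {c : ℝ // 0 ≤ c}) (latticePt_mem_hull b hj)
      · rw [huσ.2 j hj, zero_smul]; exact Submodule.zero_mem _
    · rw [hsum]; exact hu
  obtain ⟨k, hk⟩ := (F.gen_spec ρ (b i)).1 hbi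
  have h1 : (k : ℤ) * b.coord i (F.gen ρ) = 1 := by
    have := congrArg (b.coord i) hk
    rw [map_nsmul, Module.Basis.coord_apply, Module.Basis.repr_self, Finsupp.single_eq_same,
      nsmul_eq_mul] at this
    exact_mod_cast this.symm
  have hk1 : k = 1 := by
    have := Int.isUnit_iff.1 (IsUnit.of_mul_eq_one _ h1)
    omega
  rw [hk, hk1, one_smul]

variable {F} in
/-- Two linear functions that agree on the generators of the common rays of two cones agree on
their intersection. -/
lemma pairing_eq_of_gen {σ τ : PointedCone ℝ (RealSpace N)} (hσ : σ ∈ F.cones)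
    (hτ : τ ∈ F.cones) (m m' : Module.Dual ℤ N)
    (hm : ∀ ρ : F.Ray, ρ.1 ≤ σ → ρ.1 ≤ τ → m (F.gen ρ) = m' (F.gen ρ))
    {x : RealSpace N} (hxσ : x ∈ σ) (hxτ : x ∈ τ) : pairing m x = pairing m' x := by
  classical
  obtain ⟨b, s, h⟩ := F.unimodular σ hσ
  have hx := hxσ
  rw [h, mem_hull_iff] at hx
  have hsum := sum_pairing_coord b x
  rw [← hsum, map_sum, map_sum]
  refine Finset.sum_congr rfl fun i _ => ?_
  rw [map_smul, map_smul, pairing_latticePt, pairing_latticePt]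
  by_cases h0 : pairing (b.coord i) x = 0
  · rw [h0, zero_smul, zero_smul]
  have his : i ∈ s := by
    by_contra hn
    exact h0 (hx.2 i hn)
  obtain ⟨ρ, hρ⟩ := exists_ray hσ b s h his
  have hbσ : latticePt (b i) ∈ σ := by rw [h]; exact latticePt_mem_hull b his
  have hb : latticePt (b i) ∈ σ ⊓ τ := by
    rw [← Finset.add_sum_erase _ _ (Finset.mem_univ i)] at hsum
    refine (F.inter_face σ hσ τ hτ).1.mem_of_smul_add_mem (a := pairing (b.coord i) x)
      (y := ∑ j ∈ Finset.univ.erase i, pairing (b.coord j) x • latticePt (b j)) hbσ ?_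
      (lt_of_le_of_ne (hx.1 i) (Ne.symm h0)) ?_
    · rw [h]
      refine Submodule.sum_mem _ fun j _ => ?_
      by_cases hj : j ∈ s
      · exact Submodule.smul_mem _ (⟨_, hx.1 j⟩ : {c : ℝ // 0 ≤ c}) (latticePt_mem_hull b hj)
      · rw [hx.2 j hj, zero_smul]; exact Submodule.zero_mem _
    · rw [hsum]; exact ⟨hxσ, hxτ⟩
  rw [← hρ] at hb ⊢
  rw [hm ρ (F.ray_le_of_mem ρ hb.1) (F.ray_le_of_mem ρ hb.2)]

open Classical in
lemma exists_local_courant (ρ : F.Ray) {σ : PointedCone ℝ (RealSpace N)} (hσ : σ ∈ F.cones) :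
    ∃ m : Module.Dual ℤ N, ∀ ρ' : F.Ray, ρ'.1 ≤ σ → m (F.gen ρ') = if ρ' = ρ then 1 else 0 := by
  obtain ⟨b, s, h⟩ := F.unimodular σ hσ
  by_cases hρ : ρ.1 ≤ σ
  · obtain ⟨i, _, hgi⟩ := gen_mem_of_le hσ b s h ρ hρ
    refine ⟨b.coord i, fun ρ' hρ' => ?_⟩
    obtain ⟨j, _, hgj⟩ := gen_mem_of_le hσ b s h ρ' hρ'
    rw [hgj, Module.Basis.coord_apply, Module.Basis.repr_self, Finsupp.single_apply]
    refine if_congr ?_ rfl rfl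
    rw [← F.gen_injective.eq_iff, hgi, hgj, b.injective.eq_iff]
  · refine ⟨0, fun ρ' hρ' => ?_⟩
    rw [if_neg (by rintro rfl; exact hρ hρ')]
    rfl

/-- There is exactly one Courant function for each ray. -/
lemma existsUnique_isCourant (ρ : F.Ray) : ∃! f : F.PL, F.IsCourant ρ f := by
  classical
  choose! m hm using fun σ (hσ : σ ∈ F.cones) => F.exists_local_courant ρ hσ
  choose c hc hxc using fun x : F.support => x.2
  have key : ∀ (x : F.support), ∀ σ ∈ F.cones, (x : RealSpace N) ∈ σ →
      pairing (m (c x)) x = pairing (m σ) x := fun x σ hσ hx =>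
    pairing_eq_of_gen (hc x) hσ _ _
      (fun ρ' h1 h2 => (hm _ (hc x) ρ' h1).trans (hm σ hσ ρ' h2).symm) (hxc x) hx
  refine ⟨⟨fun x => pairing (m (c x)) x, fun σ hσ => ⟨m σ, fun x hx => key x σ hσ hx⟩⟩,
    ⟨?_, ?_⟩, ?_⟩
  · change pairing (m (c (F.genPt ρ))) (F.genPt ρ) = 1
    rw [key (F.genPt ρ) ρ.1 ρ.2.1 (F.gen_spec ρ).mem]
    change pairing (m ρ.1) (latticePt (F.gen ρ)) = 1
    rw [pairing_latticePt, hm ρ.1 ρ.2.1 ρ le_rfl, if_pos rfl, Int.cast_one]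
  · intro ρ' hne x hx
    change pairing (m (c x)) x = 0
    rw [key x ρ'.1 ρ'.2.1 hx]
    rw [F.ray_eq_hull ρ', PointedCone.hull, Submodule.mem_span_singleton] at hx
    obtain ⟨a, ha⟩ := hx
    rw [← ha]
    have h1 : pairing (m ρ'.1) (a • latticePt (F.gen ρ')) =
        (a : ℝ) * pairing (m ρ'.1) (latticePt (F.gen ρ')) :=
      (pairing (m ρ'.1)).map_smul (a : ℝ) _
    rw [h1, pairing_latticePt, hm ρ'.1 ρ'.2.1 ρ' le_rfl, if_neg hne, Int.cast_zero, mul_zero]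
  · rintro ⟨f, hf⟩ ⟨h1, h2⟩
    refine Subtype.ext (funext fun x => ?_)
    change f x = pairing (m (c x)) x
    obtain ⟨l, hl⟩ := hf (c x) (hc x)
    rw [hl x (hxc x)]
    refine pairing_eq_of_gen (hc x) (hc x) _ _ (fun ρ' hρ' _ => ?_) (hxc x) (hxc x)
    rw [hm _ (hc x) ρ' hρ']
    have h3 := hl (F.genPt ρ') (hρ' (F.gen_spec ρ').mem)
    have h4 : f (F.genPt ρ') = l (F.gen ρ') := h3.trans (pairing_latticePt l (F.gen ρ'))
    split_ifs with hr
    · subst hr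
      have h5 : f (F.genPt ρ') = 1 := h1
      rw [h5] at h4
      exact_mod_cast h4.symm
    · have h5 : f (F.genPt ρ') = 0 := h2 ρ' hr _ (F.gen_spec ρ').mem
      rw [h5] at h4
      exact_mod_cast h4.symm

/-- The Courant function `δ_ρ ∈ PL(Σ)`. -/
def courant (ρ : F.Ray) : F.PL := (F.existsUnique_isCourant ρ).choose

lemma courant_spec (ρ : F.Ray) : F.IsCourant ρ (F.courant ρ) :=
  (F.existsUnique_isCourant ρ).choose_spec.1

/-- The `ℤ`-algebra homomorphism `φ` on `ℤ[x_ρ]` with `φ(x_ρ) = 1 - [e^{δ_ρ}]`. -/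
def phi : MvPolynomial F.Ray ℤ →ₐ[ℤ] F.PEbar :=
  MvPolynomial.aeval fun ρ => 1 - Ideal.Quotient.mk F.linearIdeal (F.expPL (F.courant ρ))

end Courant

/-- The ideal `J` generated, for `m ∈ M`, by the differences of
`∏_{⟨m,u_ρ⟩ > 0} (1 - x_ρ)^{⟨m,u_ρ⟩}` and `∏_{⟨m,u_ρ⟩ < 0} (1 - x_ρ)^{-⟨m,u_ρ⟩}`. -/
def idealJ : Ideal (MvPolynomial F.Ray ℤ) :=
  Ideal.span (Set.range fun m : Module.Dual ℤ N =>
    (∏ ρ : F.Ray with 0 < m (F.gen ρ), (1 - MvPolynomial.X ρ) ^ (m (F.gen ρ)).toNat) -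
      ∏ ρ : F.Ray with m (F.gen ρ) < 0, (1 - MvPolynomial.X ρ) ^ (-m (F.gen ρ)).toNat)

end UnimodularFan

end ToricFan

end

/-!
Write `ψ : ℤ[x_ρ] → PE(Σ)` for the lift `x_ρ ↦ 1 - e^{δ_ρ}` of `φ`. A polynomial is killed by `ψ`
iff on every cone `σ` it vanishes as a function of the free nonpositive quantities `1 - e^{δ_ρ}`,
`ρ ∈ σ(1)`, the others being zero there; hence `ker ψ = I`. As every piecewise-linear function is an
integral combination of Courant functions, each `e^f` is a quotient of values of `ψ` on products of
the `1 - x_ρ`, so `ψ` presents `PE(Σ)` as the localization of `ℤ[x_ρ] / I` at these elements.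
The relations `e^ℓ = 1` become, after clearing denominators, the generators of `J`. It remains to
see that nothing was inverted in the end: if a prime `P ⊇ I + J` missed some `x_ρ`, then by `I` the
variables outside `P` would belong to a single cone `σ`, and the generator of `J` given by the
`m ∈ M` dual to `u_ρ` on `σ` would reduce to `(1 - x_ρ) - 1` modulo `P`. So the `x_ρ` are nilpotent
modulo `I + J`, and each `1 - x_ρ` is already a unit there.
-/

namespace ToricFan

section Fractions

variable {R S T : Type*} [CommRing R] [CommRing S] [CommRing T] {ψ : R →+* S} {M : Submonoid R}
  {J : Ideal R} {π : S →+* T}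

lemma exists_mul_eq_map_of_mem_map (hM : ∀ s, ∃ m ∈ M, ψ m * s ∈ ψ.range) {s : S}
    (hs : s ∈ J.map ψ) : ∃ m ∈ M, ∃ q ∈ J, ψ m * s = ψ q := by
  induction hs using Submodule.span_induction with
  | mem _ h =>
    obtain ⟨q, hq, rfl⟩ := h
    exact ⟨1, M.one_mem, q, hq, by rw [map_one, one_mul]⟩
  | zero => exact ⟨1, M.one_mem, 0, J.zero_mem, by simp⟩
  | add s t _ _ hs ht =>
    obtain ⟨m, hm, q, hq, hms⟩ := hs
    obtain ⟨n, hn, r, hr, hnt⟩ := ht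
    refine ⟨m * n, M.mul_mem hm hn, n * q + m * r,
      J.add_mem (J.mul_mem_left _ hq) (J.mul_mem_left _ hr), ?_⟩
    simp only [map_mul, map_add, ← hms, ← hnt]
    ring
  | smul a s _ hs =>
    obtain ⟨m, hm, q, hq, hms⟩ := hs
    obtain ⟨n, hn, r, hna⟩ := hM a
    refine ⟨m * n, M.mul_mem hm hn, r * q, J.mul_mem_left _ hq, ?_⟩
    simp only [map_mul, ← hms, hna, smul_eq_mul]
    ring

lemma ker_comp_of_fractions (hM : ∀ s, ∃ m ∈ M, ψ m * s ∈ ψ.range)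
    (hunit : ∀ m ∈ M, IsUnit (Ideal.Quotient.mk (RingHom.ker ψ ⊔ J) m))
    (hπ : RingHom.ker π = J.map ψ) : RingHom.ker (π.comp ψ) = RingHom.ker ψ ⊔ J := by
  refine le_antisymm (fun p hp => ?_) (sup_le (fun p hp => ?_) (fun p hp => ?_))
  · have hp : ψ p ∈ J.map ψ := hπ ▸ hp
    obtain ⟨m, hm, q, hq, hmq⟩ := exists_mul_eq_map_of_mem_map hM hp
    have hker : m * p - q ∈ RingHom.ker ψ := by
      rw [RingHom.mem_ker, map_sub, map_mul, hmq, sub_self]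
    have hmp : m * p ∈ RingHom.ker ψ ⊔ J :=
      sub_add_cancel (m * p) q ▸ add_mem (Ideal.mem_sup_left hker) (Ideal.mem_sup_right hq)
    rw [← Ideal.Quotient.eq_zero_iff_mem, map_mul, (hunit m hm).mul_right_eq_zero] at hmp
    exact Ideal.Quotient.eq_zero_iff_mem.1 hmp
  · rw [RingHom.mem_ker, RingHom.comp_apply, (RingHom.mem_ker).1 hp, map_zero]
  · have : ψ p ∈ RingHom.ker π := hπ ▸ Ideal.mem_map_of_mem ψ hp
    exact this

lemma surjective_comp_of_fractions (hM : ∀ s, ∃ m ∈ M, ψ m * s ∈ ψ.range)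
    (hunit : ∀ m ∈ M, IsUnit (Ideal.Quotient.mk (RingHom.ker (π.comp ψ)) m))
    (hπ : Function.Surjective π) : Function.Surjective (π.comp ψ) := by
  intro t
  obtain ⟨s, rfl⟩ := hπ t
  obtain ⟨m, hm, q, hq⟩ := hM s
  obtain ⟨n, hn⟩ := (hunit m hm).exists_left_inv
  obtain ⟨n, rfl⟩ := Ideal.Quotient.mk_surjective n
  have hnm : π (ψ n) * π (ψ m) = 1 := by
    rw [← map_mul, ← map_one (Ideal.Quotient.mk _), Ideal.Quotient.mk_eq_mk_iff_sub_mem,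
      RingHom.mem_ker, map_sub, map_mul, map_one, sub_eq_zero] at hn
    exact hn
  refine ⟨n * q, ?_⟩
  rw [RingHom.comp_apply, map_mul, hq, map_mul, map_mul, ← mul_assoc, hnm, one_mul]

end Fractions

section Polynomials

variable {ι R : Type*}

open Classical in
lemma aeval_killCompl_subtype [CommSemiring R] {s : Set ι} (z : s → R) (p : MvPolynomial ι R) :
    MvPolynomial.aeval z (MvPolynomial.killCompl Subtype.val_injective p) =
      MvPolynomial.aeval (fun i => if h : i ∈ s then z ⟨i, h⟩ else 0) p := by
  have h : (MvPolynomial.aeval z).comp (MvPolynomial.killCompl Subtype.val_injective) =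
      MvPolynomial.aeval (R := R) (fun i => if h : i ∈ s then z ⟨i, h⟩ else 0) := by
    refine MvPolynomial.algHom_ext fun i => ?_
    by_cases hi : i ∈ s
    · have hX : (MvPolynomial.X i : MvPolynomial ι R) =
          MvPolynomial.rename Subtype.val (MvPolynomial.X ⟨i, hi⟩ : MvPolynomial s R) := by simp
      rw [AlgHom.comp_apply, hX, MvPolynomial.killCompl_rename_app]
      simp [hi]
    · simp [MvPolynomial.killCompl, hi]
  exact congrArg (· p) h

lemma coeff_eq_zero_of_eval_eq_zero [CommRing R] [IsDomain R] {A : Set R} (hA : A.Infinite)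
    {p : MvPolynomial ι R} {s : Set ι}
    (h : ∀ z : ι → R, (∀ i ∈ s, z i ∈ A) → (∀ i ∉ s, z i = 0) → MvPolynomial.eval z p = 0)
    {d : ι →₀ ℕ} (hd : ↑d.support ⊆ s) : p.coeff d = 0 := by
  classical
  have hzero : MvPolynomial.killCompl (Subtype.val_injective (p := (· ∈ s))) p = 0 := by
    refine MvPolynomial.funext_set (fun _ => A) (fun _ => hA) fun z hz => ?_
    rw [map_zero, ← MvPolynomial.coe_aeval_eq_eval, RingHom.coe_coe, aeval_killCompl_subtype]
    refine h _ (fun i hi => ?_) fun i hi => dif_neg hi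
    simpa only [dif_pos hi] using hz ⟨i, hi⟩ (Set.mem_univ _)
  rw [← Subtype.range_coe (s := s)] at hd
  rw [← Finsupp.mapDomain_comapDomain (Subtype.val : s → ι) Subtype.val_injective d hd,
    ← MvPolynomial.coeff_killCompl Subtype.val_injective, hzero, MvPolynomial.coeff_zero]

lemma prod_filter_pos_pow_toNat [Fintype ι] [CommMonoid R] (n : ι → ℤ) (a : ι → R) :
    ∏ i with 0 < n i, a i ^ (n i).toNat = ∏ i, a i ^ (n i).toNat := by
  refine Finset.prod_filter_of_ne fun i _ hi => ?_
  contrapose! hi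
  rw [Int.toNat_of_nonpos hi, pow_zero]

end Polynomials

namespace Fan

variable {N : Type*} [AddCommGroup N] (F : Fan N)

lemma expPL_add (f g : F.PL) : F.expPL (f + g) = F.expPL f * F.expPL g :=
  Subtype.ext (funext fun _ => Real.exp_add _ _)

lemma isUnit_expPL (f : F.PL) : IsUnit (F.expPL f) := by
  refine IsUnit.of_mul_eq_one (F.expPL (-f)) ?_
  rw [← expPL_add, add_neg_cancel]
  exact Subtype.ext (funext fun _ => Real.exp_zero)

lemma expPL_sum_nsmul {ι : Type*} [Fintype ι] (n : ι → ℕ) (f : ι → F.PL) :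
    F.expPL (∑ i, n i • f i) = ∏ i, F.expPL (f i) ^ n i := by
  refine Subtype.ext (funext fun x => ?_)
  simp [expPL, Real.exp_sum, Real.exp_nat_mul]

lemma closure_range_expPL : AddSubgroup.closure (Set.range F.expPL) = ⊤ := by
  refine (AddSubgroup.eq_top_iff' _).2 fun G => ?_
  obtain ⟨n, a, f, h⟩ := G.2
  have hG : G = ∑ i, a i • F.expPL (f i) := by
    refine Subtype.ext (funext fun x => ?_)
    simp [h, expPL]
  rw [hG]
  exact sum_mem fun i _ => zsmul_mem (AddSubgroup.subset_closure (Set.mem_range_self _)) _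

/-- The element of `PL(Σ)` given by the linear form `m ∈ M`. -/
noncomputable def linearPL (m : Module.Dual ℤ N) : F.PL :=
  ⟨fun x => pairing m x, fun _ _ => ⟨m, fun _ _ => rfl⟩⟩

lemma linearIdeal_eq_span :
    F.linearIdeal = Ideal.span (Set.range fun m => F.expPL (F.linearPL m) - 1) := by
  refine congrArg Ideal.span (Set.Subset.antisymm ?_ ?_)
  · rintro _ ⟨⟨l, m, hl⟩, rfl⟩
    obtain rfl : l = fun x : F.support => pairing m x := funext hl
    exact ⟨m, rfl⟩
  · rintro _ ⟨m, rfl⟩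
    exact ⟨⟨_, m, fun _ => rfl⟩, rfl⟩

lemma mem_idealI_of_forall_mem_support {p : MvPolynomial F.Ray ℤ}
    (h : ∀ d ∈ p.support, ¬ ∃ σ ∈ F.cones, ∀ ρ ∈ d.support, ρ.1 ≤ σ) : p ∈ F.idealI := by
  rw [p.as_sum]
  refine sum_mem fun d hd => ?_
  rw [MvPolynomial.monomial_eq]
  refine Ideal.mul_mem_left _ _ (Ideal.mem_of_dvd _ ?_ (Ideal.subset_span ⟨_, h d hd, rfl⟩))
  exact Finset.prod_dvd_prod_of_dvd _ _ fun ρ hρ => dvd_pow_self _ (Finsupp.mem_support_iff.1 hρ)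

lemma exists_cone_of_isPrime {P : Ideal (MvPolynomial F.Ray ℤ)} [P.IsPrime] (hI : F.idealI ≤ P) :
    ∃ σ ∈ F.cones, ∀ ρ : F.Ray, MvPolynomial.X ρ ∉ P → ρ.1 ≤ σ := by
  classical
  by_contra! h
  have hmem : ∏ ρ : F.Ray with MvPolynomial.X ρ ∉ P, MvPolynomial.X ρ ∈ P :=
    hI (Ideal.subset_span ⟨_, by simpa using h, rfl⟩)
  obtain ⟨ρ, hρ, hX⟩ := Ideal.IsPrime.prod_mem_iff.1 hmem
  exact (Finset.mem_filter.1 hρ).2 hX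

/-- The monomial `∏ (1 - x_ρ)^{n_ρ}` in the elements `1 - x_ρ`, which represent the classes
`[e^{δ_ρ}]`. -/
noncomputable def oneSubXPow (n : F.Ray → ℕ) : MvPolynomial F.Ray ℤ :=
  ∏ ρ, (1 - MvPolynomial.X ρ) ^ n ρ

/-- The multiplicative set generated by the `1 - x_ρ`: the denominators needed to reach all of
`PE(Σ)` from `ℤ[x_ρ]`. -/
noncomputable def oneSubXMonoid : Submonoid (MvPolynomial F.Ray ℤ) :=
  Submonoid.closure (Set.range fun ρ => 1 - MvPolynomial.X ρ)

lemma oneSubXPow_mem (n : F.Ray → ℕ) : F.oneSubXPow n ∈ F.oneSubXMonoid :=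
  prod_mem fun ρ _ => pow_mem (Submonoid.subset_closure (Set.mem_range_self ρ)) _

end Fan

namespace UnimodularFan

variable {N : Type*} [AddCommGroup N] (F : UnimodularFan N)

lemma exists_dual_eqOn (f : F.PL) {σ : PointedCone ℝ (RealSpace N)} (hσ : σ ∈ F.cones) :
    ∃ m : Module.Dual ℤ N, (∀ x : F.support, (x : RealSpace N) ∈ σ → f.1 x = pairing m x) ∧
      ∀ ρ : F.Ray, ρ.1 ≤ σ → f.1 (F.genPt ρ) = m (F.gen ρ) := by
  obtain ⟨m, hm⟩ := f.2 σ hσ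
  exact ⟨m, hm, fun ρ hρ => (hm _ (hρ (F.gen_spec ρ).mem)).trans (pairing_latticePt m _)⟩

lemma exists_int_eq_apply_genPt (f : F.PL) (ρ : F.Ray) : ∃ n : ℤ, f.1 (F.genPt ρ) = n := by
  obtain ⟨m, -, hm⟩ := F.exists_dual_eqOn f ρ.2.1
  exact ⟨m (F.gen ρ), hm ρ le_rfl⟩

lemma exists_mem_support_forall_PL_eq_sum {σ : PointedCone ℝ (RealSpace N)} (hσ : σ ∈ F.cones)
    {t : F.Ray → ℝ} (ht : ∀ ρ, 0 ≤ t ρ) (htσ : ∀ ρ : F.Ray, ¬ ρ.1 ≤ σ → t ρ = 0) :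
    ∃ x : F.support, ∀ f : F.PL, f.1 x = ∑ ρ, t ρ * f.1 (F.genPt ρ) := by
  have hx : ∑ ρ, t ρ • latticePt (F.gen ρ) ∈ σ := by
    refine sum_mem fun ρ _ => ?_
    by_cases hρ : ρ.1 ≤ σ
    · exact σ.smul_mem (ht ρ) (hρ (F.gen_spec ρ).mem)
    · rw [htσ ρ hρ, zero_smul]
      exact σ.zero_mem
  refine ⟨⟨_, σ, hσ, hx⟩, fun f => ?_⟩
  obtain ⟨m, hm, hgen⟩ := F.exists_dual_eqOn f hσ
  rw [hm _ hx, map_sum]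
  refine Finset.sum_congr rfl fun ρ _ => ?_
  by_cases hρ : ρ.1 ≤ σ
  · rw [map_smul, pairing_latticePt, hgen ρ hρ, smul_eq_mul]
  · rw [htσ ρ hρ, zero_smul, map_zero, zero_mul]

lemma idealJ_eq_span :
    F.idealJ = Ideal.span (Set.range fun m : Module.Dual ℤ N =>
      F.oneSubXPow (fun ρ => (m (F.gen ρ)).toNat) -
        F.oneSubXPow (fun ρ => (-m (F.gen ρ)).toNat)) := by
  refine congrArg (fun g => Ideal.span (Set.range g)) (funext fun m => ?_)
  simp only [Fan.oneSubXPow, ← prod_filter_pos_pow_toNat, neg_pos]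

variable [Module.Free ℤ N]

variable {F} in
lemma PL_eqOn_cone {σ : PointedCone ℝ (RealSpace N)} (hσ : σ ∈ F.cones) {f g : F.PL}
    (h : ∀ ρ : F.Ray, ρ.1 ≤ σ → f.1 (F.genPt ρ) = g.1 (F.genPt ρ))
    {x : F.support} (hx : (x : RealSpace N) ∈ σ) : f.1 x = g.1 x := by
  obtain ⟨m, hm, hmgen⟩ := F.exists_dual_eqOn f hσ
  obtain ⟨m', hm', hmgen'⟩ := F.exists_dual_eqOn g hσ
  rw [hm x hx, hm' x hx]
  refine pairing_eq_of_gen hσ hσ m m' (fun ρ hρ _ => ?_) hx hx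
  exact_mod_cast (hmgen ρ hρ).symm.trans ((h ρ hρ).trans (hmgen' ρ hρ))

variable {F} in
lemma PL_ext {f g : F.PL} (h : ∀ ρ, f.1 (F.genPt ρ) = g.1 (F.genPt ρ)) : f = g := by
  refine Subtype.ext (funext fun x => ?_)
  obtain ⟨σ, hσ, hx⟩ := x.2
  exact PL_eqOn_cone hσ (fun ρ _ => h ρ) hx

open Classical in
lemma courant_genPt (ρ ρ' : F.Ray) :
    (F.courant ρ).1 (F.genPt ρ') = if ρ' = ρ then 1 else 0 := by
  split_ifs with h
  · rw [h, (F.courant_spec ρ).1]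
  · exact (F.courant_spec ρ).2 ρ' h _ (F.gen_spec ρ').mem

lemma courant_eq_zero_of_mem {σ : PointedCone ℝ (RealSpace N)} (hσ : σ ∈ F.cones) {ρ : F.Ray}
    (hρ : ¬ ρ.1 ≤ σ) {x : F.support} (hx : (x : RealSpace N) ∈ σ) : (F.courant ρ).1 x = 0 := by
  refine PL_eqOn_cone hσ (f := F.courant ρ) (g := 0) (fun ρ' hρ' => ?_) hx
  rw [courant_genPt, if_neg (by rintro rfl; exact hρ hρ')]
  rfl

lemma sum_nsmul_courant_genPt (n : F.Ray → ℕ) (ρ : F.Ray) :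
    (∑ ρ', n ρ' • F.courant ρ').1 (F.genPt ρ) = n ρ := by
  classical
  rw [AddSubgroup.val_finsetSum, Finset.sum_apply]
  simp [courant_genPt]

/-- The lift `ψ : ℤ[x_ρ] → PE(Σ)`, `x_ρ ↦ 1 - e^{δ_ρ}`, of `φ`. -/
noncomputable def phiPE : MvPolynomial F.Ray ℤ →+* F.PE :=
  (MvPolynomial.aeval fun ρ => 1 - F.expPL (F.courant ρ)).toRingHom

lemma phi_eq_comp : (F.phi : MvPolynomial F.Ray ℤ →+* F.PEbar) =
    (Ideal.Quotient.mk F.linearIdeal).comp F.phiPE :=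
  MvPolynomial.ringHom_ext (by simp) fun ρ => by simp [phi, phiPE]

lemma phiPE_apply (p : MvPolynomial F.Ray ℤ) (x : F.support) :
    (F.phiPE p).1 x = MvPolynomial.aeval (fun ρ => 1 - Real.exp ((F.courant ρ).1 x)) p := by
  have h : (Pi.evalRingHom (fun _ : F.support => ℝ) x).comp (F.PE.subtype.comp F.phiPE) =
      (MvPolynomial.aeval fun ρ => 1 - Real.exp ((F.courant ρ).1 x)).toRingHom :=
    MvPolynomial.ringHom_ext (by simp) fun ρ => by simp [phiPE, Fan.expPL]
  exact congrArg (· p) h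

lemma phiPE_oneSubXPow (n : F.Ray → ℕ) :
    F.phiPE (F.oneSubXPow n) = F.expPL (∑ ρ, n ρ • F.courant ρ) := by
  simp [Fan.oneSubXPow, Fan.expPL_sum_nsmul, phiPE]

lemma phiPE_oneSubXPow_mul_expPL {f : F.PL} {n : F.Ray → ℤ}
    (hn : ∀ ρ, f.1 (F.genPt ρ) = n ρ) :
    F.phiPE (F.oneSubXPow fun ρ => (-n ρ).toNat) * F.expPL f =
      F.phiPE (F.oneSubXPow fun ρ => (n ρ).toNat) := by
  rw [phiPE_oneSubXPow, phiPE_oneSubXPow, ← Fan.expPL_add]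
  refine congrArg F.expPL (PL_ext fun ρ => ?_)
  have hsplit : ((-n ρ).toNat : ℤ) + n ρ = (n ρ).toNat := by omega
  rw [AddSubgroup.coe_add, Pi.add_apply, hn, sum_nsmul_courant_genPt, sum_nsmul_courant_genPt]
  exact_mod_cast hsplit

lemma exists_oneSubX_mul_mem_range (G : F.PE) :
    ∃ Y ∈ F.oneSubXMonoid, F.phiPE Y * G ∈ F.phiPE.range := by
  have hG : G ∈ AddSubgroup.closure (Set.range F.expPL) := F.closure_range_expPL ▸ trivial
  induction hG using AddSubgroup.closure_induction with
  | mem _ h =>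
    obtain ⟨f, rfl⟩ := h
    choose n hn using F.exists_int_eq_apply_genPt f
    exact ⟨_, F.oneSubXPow_mem _, _, (F.phiPE_oneSubXPow_mul_expPL hn).symm⟩
  | zero => exact ⟨1, one_mem _, by rw [mul_zero]; exact zero_mem _⟩
  | add G H _ _ hG hH =>
    obtain ⟨Y, hY, hYG⟩ := hG
    obtain ⟨Z, hZ, hZH⟩ := hH
    refine ⟨Y * Z, mul_mem hY hZ, ?_⟩
    have hsum : F.phiPE (Y * Z) * (G + H) =
        F.phiPE Z * (F.phiPE Y * G) + F.phiPE Y * (F.phiPE Z * H) := by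
      rw [map_mul, mul_add, mul_assoc _ _ H, mul_comm (F.phiPE Y) (F.phiPE Z), mul_assoc]
    rw [hsum]
    exact add_mem (mul_mem ⟨Z, rfl⟩ hYG) (mul_mem ⟨Y, rfl⟩ hZH)
  | neg G _ hG =>
    obtain ⟨Y, hY, hYG⟩ := hG
    exact ⟨Y, hY, by rw [mul_neg]; exact neg_mem hYG⟩

lemma idealI_le_ker_phiPE : F.idealI ≤ RingHom.ker F.phiPE := by
  refine Ideal.span_le.2 ?_
  rintro _ ⟨T, hT, rfl⟩
  refine Subtype.ext (funext fun x => ?_)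
  obtain ⟨σ, hσ, hx⟩ := x.2
  obtain ⟨ρ, hρT, hρ⟩ : ∃ ρ ∈ T, ¬ ρ.1 ≤ σ := by
    by_contra! h
    exact hT ⟨σ, hσ, h⟩
  refine (F.phiPE_apply _ x).trans ?_
  rw [map_prod]
  refine Finset.prod_eq_zero hρT ?_
  rw [MvPolynomial.aeval_X, F.courant_eq_zero_of_mem hσ hρ hx, Real.exp_zero, sub_self]

lemma aeval_eq_zero_of_mem_ker_phiPE {p : MvPolynomial F.Ray ℤ} (hp : p ∈ RingHom.ker F.phiPE)
    {σ : PointedCone ℝ (RealSpace N)} (hσ : σ ∈ F.cones) {z : F.Ray → ℝ} (hz : ∀ ρ, z ρ ≤ 0)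
    (hzσ : ∀ ρ : F.Ray, ¬ ρ.1 ≤ σ → z ρ = 0) : MvPolynomial.aeval z p = 0 := by
  classical
  obtain ⟨x, hx⟩ := F.exists_mem_support_forall_PL_eq_sum hσ (t := fun ρ => Real.log (1 - z ρ))
    (fun ρ => Real.log_nonneg (by linarith [hz ρ])) (fun ρ hρ => by simp [hzσ ρ hρ])
  have hz_eq : z = fun ρ => 1 - Real.exp ((F.courant ρ).1 x) := by
    funext ρ
    have hcourant : (F.courant ρ).1 x = Real.log (1 - z ρ) := by simp [hx, courant_genPt]
    rw [hcourant, Real.exp_log (by linarith [hz ρ]), sub_sub_cancel]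
  rw [hz_eq, ← phiPE_apply, (RingHom.mem_ker).1 hp]
  rfl

lemma ker_phiPE : RingHom.ker F.phiPE = F.idealI := by
  refine le_antisymm (fun p hp => F.mem_idealI_of_forall_mem_support ?_) F.idealI_le_ker_phiPE
  rintro d hd ⟨σ, hσ, hdσ⟩
  have hcoeff : (p.map (Int.castRingHom ℝ)).coeff d = 0 := by
    refine coeff_eq_zero_of_eval_eq_zero (Set.Iic_infinite (0 : ℝ)) (s := {ρ : F.Ray | ρ.1 ≤ σ})
      (fun z hz hzσ => ?_) (fun ρ hρ => hdσ ρ hρ)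
    rw [MvPolynomial.eval_map]
    refine F.aeval_eq_zero_of_mem_ker_phiPE hp hσ (fun ρ => ?_) hzσ
    by_cases hρ : ρ.1 ≤ σ
    exacts [hz ρ hρ, (hzσ ρ hρ).le]
  rw [MvPolynomial.coeff_map, eq_intCast, Int.cast_eq_zero] at hcoeff
  exact MvPolynomial.mem_support_iff.1 hd hcoeff

lemma phiPE_oneSubXPow_sub (m : Module.Dual ℤ N) :
    F.phiPE (F.oneSubXPow (fun ρ => (m (F.gen ρ)).toNat) -
        F.oneSubXPow (fun ρ => (-m (F.gen ρ)).toNat)) =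
      F.phiPE (F.oneSubXPow fun ρ => (-m (F.gen ρ)).toNat) * (F.expPL (F.linearPL m) - 1) := by
  rw [map_sub, mul_sub, mul_one,
    F.phiPE_oneSubXPow_mul_expPL fun ρ => pairing_latticePt m (F.gen ρ)]

lemma linearIdeal_eq_map_idealJ : F.linearIdeal = F.idealJ.map F.phiPE := by
  rw [Fan.linearIdeal_eq_span, idealJ_eq_span, Ideal.map_span, ← Set.range_comp]
  refine le_antisymm (Ideal.span_le.2 ?_) (Ideal.span_le.2 ?_)
  · rintro _ ⟨m, rfl⟩
    have hunit := F.isUnit_expPL (∑ ρ, (-m (F.gen ρ)).toNat • F.courant ρ)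
    rw [← phiPE_oneSubXPow] at hunit
    rw [SetLike.mem_coe, ← Ideal.unit_mul_mem_iff_mem _ hunit, ← phiPE_oneSubXPow_sub]
    exact Ideal.subset_span ⟨m, rfl⟩
  · rintro _ ⟨m, rfl⟩
    rw [Function.comp_apply, phiPE_oneSubXPow_sub]
    exact Ideal.mul_mem_left _ _ (Ideal.subset_span ⟨m, rfl⟩)

lemma X_mem_of_isPrime {P : Ideal (MvPolynomial F.Ray ℤ)} [P.IsPrime]
    (hI : F.idealI ≤ P) (hJ : F.idealJ ≤ P) (ρ : F.Ray) : MvPolynomial.X ρ ∈ P := by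
  classical
  by_contra hρ
  obtain ⟨σ, hσ, hP⟩ := F.exists_cone_of_isPrime hI
  obtain ⟨m, hm⟩ := F.exists_local_courant ρ hσ
  have hX : ∀ ρ', ¬ ρ'.1 ≤ σ → Ideal.Quotient.mk P (MvPolynomial.X ρ') = 0 := fun ρ' hρ' =>
    Ideal.Quotient.eq_zero_iff_mem.2 (by_contra fun h => hρ' (hP ρ' h))
  have hpos : Ideal.Quotient.mk P (F.oneSubXPow fun ρ' => (m (F.gen ρ')).toNat) =
      1 - Ideal.Quotient.mk P (MvPolynomial.X ρ) := by
    rw [Fan.oneSubXPow, map_prod, Finset.prod_eq_single ρ _ (by simp)]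
    · simp [hm ρ (hP ρ hρ)]
    · intro ρ' _ hne
      by_cases hρ' : ρ'.1 ≤ σ
      · simp [hm ρ' hρ', hne]
      · simp [hX ρ' hρ']
  have hneg : Ideal.Quotient.mk P (F.oneSubXPow fun ρ' => (-m (F.gen ρ')).toNat) = 1 := by
    rw [Fan.oneSubXPow, map_prod]
    refine Finset.prod_eq_one fun ρ' _ => ?_
    by_cases hρ' : ρ'.1 ≤ σ
    · have hnat : (-m (F.gen ρ')).toNat = 0 := by rw [hm ρ' hρ']; split_ifs <;> rfl
      rw [hnat, pow_zero, map_one]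
    · simp [hX ρ' hρ']
  have hrel : F.oneSubXPow (fun ρ' => (m (F.gen ρ')).toNat) -
      F.oneSubXPow (fun ρ' => (-m (F.gen ρ')).toNat) ∈ P := by
    refine hJ ?_
    rw [idealJ_eq_span]
    exact Ideal.subset_span (Set.mem_range_self m)
  rw [← Ideal.Quotient.eq_zero_iff_mem, map_sub, hpos, hneg, sub_sub_cancel_left, neg_eq_zero,
    Ideal.Quotient.eq_zero_iff_mem] at hrel
  exact hρ hrel

lemma isNilpotent_mk_X (ρ : F.Ray) :
    IsNilpotent (Ideal.Quotient.mk (F.idealI ⊔ F.idealJ) (MvPolynomial.X ρ)) := by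
  have hrad : MvPolynomial.X ρ ∈ (F.idealI ⊔ F.idealJ).radical := by
    rw [Ideal.radical_eq_sInf, Ideal.mem_sInf]
    rintro P ⟨hP, _⟩
    exact F.X_mem_of_isPrime (le_sup_left.trans hP) (le_sup_right.trans hP) ρ
  obtain ⟨k, hk⟩ := hrad
  exact ⟨k, by rwa [← map_pow, Ideal.Quotient.eq_zero_iff_mem]⟩

lemma isUnit_mk_of_mem_oneSubXMonoid {Y : MvPolynomial F.Ray ℤ} (hY : Y ∈ F.oneSubXMonoid) :
    IsUnit (Ideal.Quotient.mk (F.idealI ⊔ F.idealJ) Y) := by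
  suffices h : F.oneSubXMonoid ≤
      (IsUnit.submonoid _).comap (Ideal.Quotient.mk (F.idealI ⊔ F.idealJ)) from h hY
  refine Submonoid.closure_le.2 ?_
  rintro _ ⟨ρ, rfl⟩
  change IsUnit (Ideal.Quotient.mk _ (1 - MvPolynomial.X ρ))
  rw [map_sub, map_one]
  exact (F.isNilpotent_mk_X ρ).isUnit_one_sub

lemma ker_phi : RingHom.ker F.phi = F.idealI ⊔ F.idealJ := by
  change RingHom.ker (F.phi : MvPolynomial F.Ray ℤ →+* F.PEbar) = _
  rw [phi_eq_comp, ← ker_phiPE]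
  refine ker_comp_of_fractions F.exists_oneSubX_mul_mem_range (fun Y hY => ?_)
    (Ideal.mk_ker.trans F.linearIdeal_eq_map_idealJ)
  rw [ker_phiPE]
  exact F.isUnit_mk_of_mem_oneSubXMonoid hY

lemma phi_surjective : Function.Surjective F.phi := by
  change Function.Surjective (F.phi : MvPolynomial F.Ray ℤ →+* F.PEbar)
  rw [phi_eq_comp]
  refine surjective_comp_of_fractions F.exists_oneSubX_mul_mem_range (fun Y hY => ?_)
    Ideal.Quotient.mk_surjective
  rw [← phi_eq_comp]
  change IsUnit (Ideal.Quotient.mk (RingHom.ker F.phi) Y)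
  rw [ker_phi]
  exact F.isUnit_mk_of_mem_oneSubXMonoid hY

end UnimodularFan

end ToricFan

theorem theorem1p2 {N : Type*} [AddCommGroup N] [Module.Free ℤ N] [Module.Finite ℤ N]
    (F : ToricFan.UnimodularFan N) :
    Function.Surjective F.phi ∧
      RingHom.ker F.phi = F.idealI ⊔ F.idealJ ∧
      ∃ e : (MvPolynomial F.Ray ℤ ⧸ (F.idealI ⊔ F.idealJ)) ≃ₐ[ℤ] F.PEbar,
        ∀ p : MvPolynomial F.Ray ℤ, e (Ideal.Quotient.mk _ p) = F.phi p :=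
  ⟨F.phi_surjective, F.ker_phi,
    (Ideal.quotientEquivAlgOfEq ℤ F.ker_phi.symm).trans
      (Ideal.quotientKerAlgEquivOfSurjective F.phi_surjective),
    fun _ => rfl⟩
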